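/- For a well quasi-order $A$, let $\mathrm{Inco}(A)$ be the set of non-empty finite sequences of pairwise incomparable elements of $A$, viewed as a forest in which the children of $s=(x_1,\dots,x_l)$ are the sequences $(x_1,\dots,x_l,y)\in\mathrm{Inco}(A)$. It is well-founded; let $r(s)=\sup\{r(t)+1 : t \text{ a child of } s\}$ be the rank of a node $s$ (so leaves have rank $0$), and define the width of $A$ as the ordinal $w(A)=\sup\{r(s)+1 : s\in \mathrm{Inco}(A)\}$ (so $w(\emptyset)=0$). Let $\otimes$ denote the natural (Hessenberg) product of ordinals: if $\alpha=\sum_i\omega^{\alpha_i}m_i$ and $\beta=\sum_j\omega^{\beta_j}n_j$ in Cantor normal form, then $\alpha\otimes\beta=\bigoplus_{i,j}\omega^{\alpha_i\oplus\beta_j}m_in_j$, where the natural sum $\oplus$ adds the coefficients of equal powers of $\omega$ in the Cantor normal forms. Theorem. Let $n\ge 1$ and $m\ge 0$ be integers, let $\alpha_1,\dots,\alpha_n$ be infinite ordinals, let $X=\alpha_1\times\dots\times\alpha_n$ be their Cartesian product with the componentwise order, and let $k_1,\dots,k_m\in\mathbb{N}$ be finite ordinals. Then $$w(X\times k_1\times\dots\times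 k_m)=w(X)\otimes k_1\otimes\dots\otimes k_m ,$$ where $X\times k_1\times\dots\times k_m$ again carries the componentwise order. -/

import Mathlib

open scoped Ordinal

universe u

/-- The nodes of the tree `Inco(A)`: the non-empty finite sequences of pairwise incomparable
elements of `A`. -/
def Inco (A : Type u) [Preorder A] : Type u :=
  {s : List A // s ≠ [] ∧ s.Pairwise (IncompRel (· ≤ ·))}

/-- `Inco.Child t s`: the node `t` is a child of the node `s`, that is, `t` extends `s` by one
element at the end. -/
def Inco.Child {A : Type u} [Preorder A] (t s : Inco A) : Prop :=
  ∃ y : A, t.1 = s.1 ++ [y]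

instance Inco.isWellFounded_child (A : Type u) [Preorder A] [WellQuasiOrderedLE A] :
    IsWellFounded (Inco A) Inco.Child := by
  refine ⟨wellFounded_iff_isEmpty_descending_chain.2 ⟨fun ⟨f, hc⟩ => ?_⟩⟩
  choose y hy using hc
  have hmem : ∀ m n : ℕ, m < n → y m ∈ (f n).1 := by
    intro m n h
    induction n with
    | zero => omega
    | succ n ih =>
      rw [hy n, List.mem_append]
      rcases Nat.lt_succ_iff_lt_or_eq.1 h with h | rfl
      · exact Or.inl (ih h)
      · exact Or.inr (by simp)
  obtain ⟨m, n, hmn, hle⟩ := wellQuasiOrdered_le (α := A) y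
  have hp := (f (n + 1)).2.2
  rw [hy n, List.pairwise_append] at hp
  exact (hp.2.2 (y m) (hmem m n hmn) (y n) (by simp)).1 hle

/-- The width of a well quasi-order `A`: the rank of the well-founded tree `Inco(A)`, that is,
the supremum of `r(s) + 1` over its nodes `s`, where `r(s)` is the supremum of `r(t) + 1` over the
children `t` of `s` (so that leaves have rank `0`). -/
noncomputable def width (A : Type u) [Preorder A] [WellQuasiOrderedLE A] : Ordinal.{u} :=
  ⨆ s : Inco A, (IsWellFounded.rank Inco.Child s + 1)

/-- The natural (Hessenberg) sum of two ordinals: add the coefficients of equal powers of `ω` in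
the Cantor normal forms. -/
noncomputable def natAdd (a b : Ordinal.{u}) : Ordinal.{u} :=
  Ordinal.CNF.eval ω (Ordinal.CNF.coeff ω a + Ordinal.CNF.coeff ω b)

/-- The natural (Hessenberg) product of two ordinals: if `∑ᵢ ω ^ aᵢ * mᵢ` and `∑ⱼ ω ^ bⱼ * nⱼ` are
their Cantor normal forms, it is the natural sum, over all pairs `(i, j)`, of
`ω ^ (aᵢ ⊕ bⱼ) * (mᵢ * nⱼ)`, where `⊕` is the natural sum. -/
noncomputable def natMul (a b : Ordinal.{u}) : Ordinal.{u} :=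
  ((Ordinal.CNF ω a ×ˢ Ordinal.CNF ω b).map
    fun p => ω ^ natAdd p.1.1 p.2.1 * (p.1.2 * p.2.2)).foldr natAdd 0

/-! Playing `y` in `S` leaves the elements of `S` incomparable to `y`, and the width of `S` is the
least ordinal above the widths of all these residuals. The natural product with a finite ordinal
multiplies every Cantor normal form coefficient, so the claim is that w(X × P) is the natural sum of
|P| copies of w(X); this holds for every finite partial order P (`width_prod_eq`).

Upper bound: the fibres over P are copies of X, and width is subadditive for the natural sum
(`setWidth_le_natSum`).

Lower bound: cutting each factor along its Cantor normal form splits X into boxes with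
indecomposable sides, whose widths are powers of ω (`exists_setWidth_box_eq`). Call a block minimal
if it uses the first piece of some factor. The natural sum of the widths of the minimal blocks
bounds w(X) from above (`setWidth_univ_le_natSum_block`). In X × P, all copies of minimal blocks can
be played in turn, smallest width first, so that the ordinary sum obtained is the natural sum
(`natSum_le_setWidth_univ`). Earlier moves do not spoil later blocks, because one can shift past
finitely many points of a first piece, which is infinite as the factors are
(`setWidth_block_le_of_finite`). -/

/-! ### Ordinals as finitely supported functions `Ordinal →₀ ℕ` -/

section Coefficients

open Ordinal Finsupp

/-- The ordinal with the given coefficients in its Cantor normal form. -/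
noncomputable def ofCoeffs (f : Ordinal.{u} →₀ ℕ) : Ordinal.{u} :=
  CNF.eval ω (f.mapRange (Nat.cast : ℕ → Ordinal.{u}) Nat.cast_zero)

theorem coeff_omega0_lt (o e : Ordinal.{u}) : CNF.coeff ω o e < ω := by
  by_cases h : e ∈ (CNF ω o).map Prod.fst
  · obtain ⟨⟨e, c⟩, hc, rfl⟩ := List.mem_map.1 h
    rw [CNF.coeff_of_mem_CNF hc]
    exact CNF.snd_lt one_lt_omega0 hc
  · rw [CNF.coeff_of_notMem_CNF h]
    exact omega0_pos

theorem exists_mapRange_eq {g : Ordinal.{u} →₀ Ordinal.{u}} (hg : ∀ e, g e < ω) :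
    ∃ f : Ordinal.{u} →₀ ℕ, f.mapRange (Nat.cast : ℕ → Ordinal.{u}) Nat.cast_zero = g := by
  choose c hc using fun e => lt_omega0.1 (hg e)
  refine ⟨onFinset g.support c fun e he => ?_, ?_⟩
  · rw [mem_support_iff, hc e]
    exact_mod_cast he
  · ext e
    simp [hc e]

theorem mapRange_natCast_injective : Function.Injective
    fun f : Ordinal.{u} →₀ ℕ => f.mapRange (Nat.cast : ℕ → Ordinal.{u}) Nat.cast_zero :=
  mapRange_injective _ _ Nat.cast_injective

theorem coeff_ofCoeffs (f : Ordinal.{u} →₀ ℕ) :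
    CNF.coeff ω (ofCoeffs f) = f.mapRange (Nat.cast : ℕ → Ordinal.{u}) Nat.cast_zero := by
  refine CNF.coeff_eval one_lt_omega0 fun e => ?_
  simp [natCast_lt_omega0]

theorem ofCoeffs_injective : Function.Injective (ofCoeffs.{u}) := fun f g h => by
  have := congrArg (CNF.coeff ω) h
  rw [coeff_ofCoeffs, coeff_ofCoeffs] at this
  exact mapRange_natCast_injective this

theorem ofCoeffs_surjective : Function.Surjective (ofCoeffs.{u}) := fun o => by
  obtain ⟨f, hf⟩ := exists_mapRange_eq (coeff_omega0_lt o)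
  exact ⟨f, by rw [ofCoeffs, hf, CNF.eval_coeff]⟩

/-- The coefficients of the Cantor normal form of an ordinal, as natural numbers. -/
noncomputable def toCoeffs (o : Ordinal.{u}) : Ordinal.{u} →₀ ℕ :=
  (ofCoeffs_surjective o).choose

@[simp]
theorem ofCoeffs_toCoeffs (o : Ordinal.{u}) : ofCoeffs (toCoeffs o) = o :=
  (ofCoeffs_surjective o).choose_spec

@[simp]
theorem toCoeffs_ofCoeffs (f : Ordinal.{u} →₀ ℕ) : toCoeffs (ofCoeffs f) = f :=
  ofCoeffs_injective (by simp)

@[simp]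
theorem ofCoeffs_zero : ofCoeffs (0 : Ordinal.{u} →₀ ℕ) = 0 := by
  simp [ofCoeffs]

@[simp]
theorem ofCoeffs_single (e : Ordinal.{u}) (n : ℕ) : ofCoeffs (single e n) = ω ^ e * n := by
  simp [ofCoeffs]

theorem toCoeffs_omega0_opow_mul (e : Ordinal.{u}) (n : ℕ) :
    toCoeffs (ω ^ e * n) = single e n := by
  rw [← ofCoeffs_single, toCoeffs_ofCoeffs]

theorem toCoeffs_omega0_opow (e : Ordinal.{u}) : toCoeffs (ω ^ e) = single e 1 := by
  simpa using toCoeffs_omega0_opow_mul e 1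

theorem ofCoeffs_add {f g : Ordinal.{u} →₀ ℕ}
    (h : ∀ e₁, f e₁ ≠ 0 → ∀ e₂, g e₂ ≠ 0 → e₂ ≤ e₁) :
    ofCoeffs (f + g) = ofCoeffs f + ofCoeffs g := by
  rw [ofCoeffs, mapRange_add (by simp), CNF.eval_add]
  · rfl
  · simpa using h

theorem ofCoeffs_lt_omega0_opow {f : Ordinal.{u} →₀ ℕ} {e : Ordinal.{u}}
    (h : ∀ e', f e' ≠ 0 → e' < e) : ofCoeffs f < ω ^ e :=
  CNF.eval_lt (by simp [natCast_lt_omega0]) (by simpa using h)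

/-- Split off the terms above `e`, which agree; the terms of `f` below `e` sum to less than `ω ^ e`,
so they cannot make up for one missing copy of it. -/
theorem ofCoeffs_lt_ofCoeffs {f g : Ordinal.{u} →₀ ℕ} {e : Ordinal.{u}}
    (he : f e < g e) (h : ∀ e', e < e' → f e' = g e') : ofCoeffs f < ofCoeffs g := by
  have split (f : Ordinal.{u} →₀ ℕ) : ofCoeffs f = ofCoeffs (f.filter (e < ·)) +
      (ω ^ e * f e + ofCoeffs (f.filter (· < e))) := by
    rw [← ofCoeffs_single, ← ofCoeffs_add, ← ofCoeffs_add]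
    · congr 1
      ext e'
      rcases lt_trichotomy e e' with h | rfl | h
      · simp [h, h.ne, h.not_gt]
      · simp
      · simp [h, h.ne', h.not_gt]
    · intro e₁ h₁ e₂ h₂
      have h₁ : e < e₁ := by by_contra h; simp [h] at h₁
      by_contra hlt
      have := (h₁.trans (not_le.1 hlt))
      simp [this.not_gt, this.ne'] at h₂
    · intro e₁ h₁ e₂ h₂
      have h₁ : e = e₁ := by by_contra h; simp [h] at h₁
      have h₂ : e₂ < e := by by_contra h; simp [h] at h₂
      exact h₁ ▸ h₂.le
  have hhigh : f.filter (e < ·) = g.filter (e < ·) := by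
    ext e'
    by_cases he' : e < e'
    · simp [he', h e' he']
    · simp [he']
  rw [split f, split g, hhigh, add_lt_add_iff_left]
  calc ω ^ e * f e + ofCoeffs (f.filter (· < e)) < ω ^ e * f e + ω ^ e := by
        rw [add_lt_add_iff_left]
        refine ofCoeffs_lt_omega0_opow fun e' he' => ?_
        by_contra h
        simp [h] at he'
    _ = ω ^ e * (f e + 1 : ℕ) := by push_cast; rw [mul_add_one]
    _ ≤ ω ^ e * g e := by gcongr; exact_mod_cast he
    _ ≤ _ := le_self_add

theorem ofCoeffs_lt_ofCoeffs_iff {f g : Ordinal.{u} →₀ ℕ} :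
    ofCoeffs f < ofCoeffs g ↔ ∃ e, f e < g e ∧ ∀ e', e < e' → f e' = g e' := by
  refine ⟨fun h => ?_, fun ⟨e, he, h⟩ => ofCoeffs_lt_ofCoeffs he h⟩
  have hne : (f.neLocus g).Nonempty := by
    rw [nonempty_neLocus_iff]
    rintro rfl
    exact h.false
  have hmem := (f.neLocus g).max'_mem hne
  have hgt : ∀ e', (f.neLocus g).max' hne < e' → f e' = g e' := fun e' he' => by
    by_contra h
    exact he'.not_ge ((f.neLocus g).le_max' _ (mem_neLocus.2 h))
  rcases lt_or_gt_of_ne (mem_neLocus.1 hmem) with h' | h'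
  · exact ⟨_, h', hgt⟩
  · exact absurd (ofCoeffs_lt_ofCoeffs h' fun e' he' => (hgt e' he').symm) h.not_gt

theorem ofCoeffs_add_lt {f g : Ordinal.{u} →₀ ℕ} (h : ofCoeffs f < ofCoeffs g)
    (k : Ordinal.{u} →₀ ℕ) : ofCoeffs (f + k) < ofCoeffs (g + k) := by
  rw [ofCoeffs_lt_ofCoeffs_iff] at h ⊢
  obtain ⟨e, he, h⟩ := h
  exact ⟨e, by simpa using he, fun e' he' => by simp [h e' he']⟩

theorem ofCoeffs_add_le {f g : Ordinal.{u} →₀ ℕ} (h : ofCoeffs f ≤ ofCoeffs g)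
    (k : Ordinal.{u} →₀ ℕ) : ofCoeffs (f + k) ≤ ofCoeffs (g + k) := by
  rcases h.eq_or_lt with h | h
  · rw [ofCoeffs_injective h]
  · exact (ofCoeffs_add_lt h k).le

/-- The natural sum of a finite family of ordinals. -/
noncomputable def natSum {ι : Type*} (s : Finset ι) (a : ι → Ordinal.{u}) : Ordinal.{u} :=
  ofCoeffs (∑ i ∈ s, toCoeffs (a i))

theorem natSum_le_natSum {ι : Type*} {s : Finset ι} {a b : ι → Ordinal.{u}}
    (h : ∀ i ∈ s, a i ≤ b i) : natSum s a ≤ natSum s b := by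
  classical
  induction s using Finset.induction_on with
  | empty => rfl
  | insert i s hi ih =>
    simp only [natSum, Finset.sum_insert hi] at ih ⊢
    calc _ ≤ ofCoeffs (toCoeffs (b i) + ∑ i ∈ s, toCoeffs (a i)) :=
          ofCoeffs_add_le (by simpa using h i (by simp)) _
      _ ≤ _ := by
          rw [add_comm, add_comm (toCoeffs (b i))]
          exact ofCoeffs_add_le (ih fun j hj => h j (by simp [hj])) _

theorem natSum_lt_natSum {ι : Type*} {s : Finset ι} {a b : ι → Ordinal.{u}}
    (h : ∀ i ∈ s, a i ≤ b i) {i : ι} (hi : i ∈ s) (hlt : a i < b i) :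
    natSum s a < natSum s b := by
  classical
  rw [natSum, natSum, ← Finset.add_sum_erase _ _ hi, ← Finset.add_sum_erase _ _ hi]
  calc _ < ofCoeffs (toCoeffs (b i) + ∑ i ∈ s.erase i, toCoeffs (a i)) :=
        ofCoeffs_add_lt (by simpa using hlt) _
    _ ≤ _ := by
        rw [add_comm, add_comm (toCoeffs (b i))]
        exact ofCoeffs_add_le
          (natSum_le_natSum fun j hj => h j (Finset.mem_of_mem_erase hj)) _

@[simp]
theorem natSum_empty {ι : Type*} (a : ι → Ordinal.{u}) : natSum ∅ a = 0 := by
  simp [natSum]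

theorem natSum_const {ι : Type*} (s : Finset ι) (a : Ordinal.{u}) :
    natSum s (fun _ => a) = ofCoeffs (s.card • toCoeffs a) := by
  simp [natSum]

/-- If every term of a natural sum is a power of `ω`, the smallest one may be added last, by the
ordinary sum. -/
theorem natSum_omega0_opow_eq_add {ι : Type*} [DecidableEq ι] {s : Finset ι}
    {γ : ι → Ordinal.{u}} {i : ι} (hi : i ∈ s) (h : ∀ j ∈ s, γ i ≤ γ j) :
    natSum s (fun j => ω ^ γ j) = natSum (s.erase i) (fun j => ω ^ γ j) + ω ^ γ i := by
  rw [natSum, ← Finset.sum_erase_add _ _ hi, ofCoeffs_add]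
  · rw [natSum, ofCoeffs_toCoeffs]
  · intro e₁ h₁ e₂ h₂
    rw [toCoeffs_omega0_opow] at h₂
    have h₂ : γ i = e₂ := by by_contra h; simp [h] at h₂
    rw [Finsupp.finsetSum_apply] at h₁
    obtain ⟨j, hj, hj'⟩ := Finset.exists_ne_zero_of_sum_ne_zero h₁
    rw [toCoeffs_omega0_opow] at hj'
    have hj' : γ j = e₁ := by by_contra h; simp [h] at hj'
    rw [← hj', ← h₂]
    exact h j (Finset.mem_of_mem_erase hj)

/-- Take `e` one more than the logarithm of the largest term. A finite natural sum stays below `ω ^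
e`, while the finite multiples of that term reach up to it. -/
theorem exists_natSum_lt_omega0_opow {ι : Type*} {s : Finset ι} {a : ι → Ordinal.{u}}
    {w : Ordinal.{u}} (hw : w ≠ 0) (h : ∀ i ∈ s, ∀ n : ℕ, a i * n ≤ w) :
    ∃ e : Ordinal.{u}, natSum s a < ω ^ e ∧ ω ^ e ≤ w := by
  have hlim := isSuccLimit_omega0
  rcases s.eq_empty_or_nonempty with rfl | hs
  · exact ⟨0, by simp, by simpa [Order.one_le_iff_pos] using hw.pos⟩
  obtain ⟨i, hi, hmax⟩ := s.exists_max_image a hs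
  -- The logarithm of `0` is `0` by convention and gives no lower bound, so this case is separate.
  by_cases h0 : a i = 0
  · refine ⟨0, ?_, by simpa [Order.one_le_iff_pos] using hw.pos⟩
    refine (natSum_le_natSum hmax).trans_lt ?_
    rw [natSum_const, h0, ← ofCoeffs_zero, toCoeffs_ofCoeffs]
    simp
  obtain ⟨n, hn⟩ : ∃ n : ℕ, a i < ω ^ log ω (a i) * n := by
    have := lt_opow_succ_log_self one_lt_omega0 (a i)
    rw [Order.succ_eq_add_one, opow_add, opow_one,
      lt_mul_iff_of_isSuccLimit hlim] at this
    obtain ⟨c, hc, hlt⟩ := this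
    obtain ⟨n, rfl⟩ := lt_omega0.1 hc
    exact ⟨n, hlt⟩
  refine ⟨log ω (a i) + 1, ?_, ?_⟩
  · refine (natSum_le_natSum fun j hj => (hmax j hj).trans hn.le).trans_lt ?_
    rw [natSum_const, toCoeffs_omega0_opow_mul, smul_single, ofCoeffs_single, opow_add, opow_one]
    exact mul_lt_mul_of_pos_left (natCast_lt_omega0 _) (opow_pos _ omega0_pos)
  · rw [opow_add, opow_one, mul_le_iff_of_isSuccLimit hlim]
    intro c hc
    obtain ⟨n, rfl⟩ := lt_omega0.1 hc
    exact (mul_le_mul_left (opow_log_le_self ω h0) _).trans (h i hi n)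

/-! ### Natural sum and natural product in terms of coefficients -/

theorem natAdd_eq (a b : Ordinal.{u}) : natAdd a b = ofCoeffs (toCoeffs a + toCoeffs b) := by
  rw [natAdd, ofCoeffs, mapRange_add (by simp), ← coeff_ofCoeffs, ← coeff_ofCoeffs,
    ofCoeffs_toCoeffs, ofCoeffs_toCoeffs]

theorem toCoeffs_natAdd (a b : Ordinal.{u}) :
    toCoeffs (natAdd a b) = toCoeffs a + toCoeffs b := by
  rw [natAdd_eq, toCoeffs_ofCoeffs]

theorem natAdd_zero (a : Ordinal.{u}) : natAdd a 0 = a := by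
  rw [natAdd_eq, ← ofCoeffs_zero, toCoeffs_ofCoeffs, add_zero, ofCoeffs_toCoeffs]

theorem CNF_natCast {k : ℕ} (hk : k ≠ 0) : CNF ω (k : Ordinal.{u}) = [(0, (k : Ordinal))] :=
  CNF.of_lt (by exact_mod_cast hk) (natCast_lt_omega0 k)

theorem toCoeffs_foldr_natAdd (l : List Ordinal.{u}) :
    toCoeffs (l.foldr natAdd 0) = (l.map toCoeffs).sum := by
  induction l with
  | nil => simpa using toCoeffs_ofCoeffs 0
  | cons a l ih => simp [toCoeffs_natAdd, ih]

/-- With decreasing exponents nothing is absorbed, so the ordinary sum is the natural one. -/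
theorem toCoeffs_foldr_omega0_opow (l : List (Ordinal.{u} × Ordinal.{u}))
    (hl : (l.map Prod.fst).SortedGT) (hlt : ∀ p ∈ l, p.2 < ω) :
    toCoeffs (l.foldr (fun p r => ω ^ p.1 * p.2 + r) 0) =
      (l.map fun p => toCoeffs (ω ^ p.1 * p.2)).sum := by
  induction l with
  | nil => simpa using toCoeffs_ofCoeffs 0
  | cons p l ih =>
    have hp := List.pairwise_cons.1 hl.pairwise
    have ih := ih hp.2.sortedGT fun q hq => hlt q (by simp [hq])
    rw [List.foldr_cons, List.map_cons, List.sum_cons, ← ih]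
    apply ofCoeffs_injective
    rw [ofCoeffs_toCoeffs, ofCoeffs_add]
    · simp
    · intro e₁ h₁ e₂ h₂
      obtain ⟨n, hn⟩ := lt_omega0.1 (hlt p (by simp))
      rw [hn, toCoeffs_omega0_opow_mul] at h₁
      have h₁ : p.1 = e₁ := by by_contra h; simp [h] at h₁
      rw [← h₁]
      by_contra hlt'
      apply h₂
      rw [ih, ← Finsupp.applyAddHom_apply, map_list_sum, List.map_map]
      refine List.sum_eq_zero fun x hx => ?_
      obtain ⟨q, hq, rfl⟩ := List.mem_map.1 hx
      obtain ⟨n, hn⟩ := lt_omega0.1 (hlt q (by simp [hq]))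
      have := (hp.1 q.1 (List.mem_map_of_mem hq)).trans (not_le.1 hlt')
      simp [hn, toCoeffs_omega0_opow_mul, this.ne]

theorem toCoeffs_eq_sum_CNF (a : Ordinal.{u}) :
    toCoeffs a = ((CNF ω a).map fun p => toCoeffs (ω ^ p.1 * p.2)).sum := by
  rw [← toCoeffs_foldr_omega0_opow _ (CNF.sortedGT ω a) fun p hp => CNF.snd_lt one_lt_omega0 hp,
    CNF.foldr]

/-- A nonzero `k` has the single Cantor term of exponent `0`, so exponents stay and coefficients are
scaled; `k = 0` has an empty normal form. -/
theorem toCoeffs_natMul_natCast (a : Ordinal.{u}) (k : ℕ) :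
    toCoeffs (natMul a k) = k • toCoeffs a := by
  rw [natMul, toCoeffs_foldr_natAdd]
  rcases eq_or_ne k 0 with rfl | hk
  · have : CNF ω a ×ˢ ([] : List (Ordinal.{u} × Ordinal.{u})) = [] := List.product_nil _
    simp [this]
  · rw [CNF_natCast hk, toCoeffs_eq_sum_CNF a, List.smul_sum, List.map_map, List.map_map]
    have : CNF ω a ×ˢ [((0 : Ordinal.{u}), (k : Ordinal.{u}))] =
        (CNF ω a).map fun p => (p, (0, (k : Ordinal.{u}))) := by
      simp [SProd.sprod, List.product, ← List.map_eq_flatMap]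
    rw [this, List.map_map]
    congr 1
    refine List.map_congr_left fun p hp => ?_
    obtain ⟨n, hn⟩ := lt_omega0.1 (CNF.snd_lt one_lt_omega0 hp)
    simp only [Function.comp_apply, natAdd_zero, hn]
    rw [← natCast_mul, toCoeffs_omega0_opow_mul, toCoeffs_omega0_opow_mul, smul_single,
      _root_.smul_eq_mul, mul_comm]

theorem foldl_natMul_natCast (l : List ℕ) (a : Ordinal.{u}) :
    (l.map (Nat.cast : ℕ → Ordinal.{u})).foldl natMul a = ofCoeffs (l.prod • toCoeffs a) := by
  induction l generalizing a with
  | nil => simp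
  | cons k l ih =>
    rw [List.map_cons, List.foldl_cons, ih, toCoeffs_natMul_natCast, List.prod_cons, mul_comm,
      mul_smul]

end Coefficients

/-! ### The width of a subset -/

section SetWidth

variable {A B : Type u} [Preorder A] [Preorder B]

/-- The elements of `S` that are incomparable to `y`. -/
def incompResidual (S : Set A) (y : A) : Set A :=
  {z ∈ S | IncompRel (· ≤ ·) z y}

theorem incompResidual_subset (S : Set A) (y : A) : incompResidual S y ⊆ S := fun _ hz => hz.1

/-- `IsResidual S' S`: the set `S'` is the residual of `S` by one of its elements. -/
def IsResidual (S' S : Set A) : Prop :=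
  ∃ y ∈ S, S' = incompResidual S y

instance isWellFounded_isResidual [WellQuasiOrderedLE A] :
    IsWellFounded (Set A) IsResidual := by
  refine ⟨wellFounded_iff_isEmpty_descending_chain.2 ⟨fun ⟨f, hc⟩ => ?_⟩⟩
  choose y hy hf using hc
  have hanti : Antitone f := antitone_nat_of_succ_le fun n => by
    rw [hf n]
    exact incompResidual_subset _ _
  obtain ⟨m, n, hmn, hle⟩ := wellQuasiOrdered_le (α := A) y
  have := hanti (Nat.succ_le_of_lt hmn) (hy n)
  rw [Nat.succ_eq_add_one, hf m] at this
  exact this.2.2 hle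

variable [WellQuasiOrderedLE A] [WellQuasiOrderedLE B]

/-- The width of a subset of a well quasi-order. -/
noncomputable def setWidth (S : Set A) : Ordinal.{u} :=
  IsWellFounded.rank IsResidual S

theorem setWidth_incompResidual_lt {S : Set A} {y : A} (hy : y ∈ S) :
    setWidth (incompResidual S y) < setWidth S :=
  IsWellFounded.rank_lt_of_rel ⟨y, hy, rfl⟩

theorem setWidth_le_iff {S : Set A} {o : Ordinal.{u}} :
    setWidth S ≤ o ↔ ∀ y ∈ S, setWidth (incompResidual S y) < o := by
  refine ⟨fun h y hy => (setWidth_incompResidual_lt hy).trans_le h, fun h => ?_⟩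
  rw [setWidth, IsWellFounded.rank_eq, Ordinal.iSup_le_iff]
  rintro ⟨_, y, hy, rfl⟩
  exact Order.succ_le_of_lt (h y hy)

theorem lt_setWidth_iff {S : Set A} {o : Ordinal.{u}} :
    o < setWidth S ↔ ∃ y ∈ S, o ≤ setWidth (incompResidual S y) := by
  rw [← not_le, setWidth_le_iff]
  push Not
  rfl

theorem incompResidual_induction {p : Set A → Prop} (S : Set A)
    (h : ∀ S, (∀ y ∈ S, p (incompResidual S y)) → p S) : p S :=
  IsWellFounded.induction IsResidual S fun S ih => h S fun y hy => ih _ ⟨y, hy, rfl⟩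

/-- Preserving incomparability suffices: moves in `S` can be copied into `T`. No order embedding is
needed. -/
theorem setWidth_le_of_map (f : A → B) {S : Set A} {T : Set B} (hf : Set.MapsTo f S T)
    (h : ∀ x ∈ S, ∀ y ∈ S, IncompRel (· ≤ ·) x y → IncompRel (· ≤ ·) (f x) (f y)) :
    setWidth S ≤ setWidth T := by
  induction S using incompResidual_induction generalizing T with | _ S ih
  rw [setWidth_le_iff]
  intro y hy
  refine (ih y hy (T := incompResidual T (f y)) (fun x hx => ⟨hf hx.1, h x hx.1 y hy hx.2⟩)
    fun x hx z hz => h x hx.1 z hz.1).trans_lt (setWidth_incompResidual_lt (hf hy))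

theorem setWidth_mono {S T : Set A} (h : S ⊆ T) : setWidth S ≤ setWidth T :=
  setWidth_le_of_map id h fun _ _ _ _ hxy => hxy

theorem setWidth_pos {S : Set A} (h : S.Nonempty) : 0 < setWidth S :=
  h.elim fun _ hy => (setWidth_incompResidual_lt hy).pos

theorem setWidth_incompResidual_inter_lt {S : Set A} {y : A} (hy : y ∈ S) (T : Set A) (hT : y ∈ T) :
    setWidth (incompResidual S y ∩ T) < setWidth (S ∩ T) := by
  refine (setWidth_mono ?_).trans_lt (setWidth_incompResidual_lt (S := S ∩ T) ⟨hy, hT⟩)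
  exact fun z hz => ⟨⟨hz.1.1, hz.2⟩, hz.1.2⟩

/-- Extending `s` amounts to playing inside the set of elements incomparable to all entries of `s`.
-/
theorem rank_child_eq_setWidth (s : Inco A) :
    IsWellFounded.rank Inco.Child s =
      setWidth {z : A | ∀ t ∈ s.1, IncompRel (· ≤ ·) z t} := by
  apply IsWellFounded.induction (motive := fun s : Inco A => IsWellFounded.rank Inco.Child s =
    setWidth {z : A | ∀ t ∈ s.1, IncompRel (· ≤ ·) z t}) Inco.Child s
  intro s ih
  have hres (y : A) (s' : List A) (hs' : s' = s.1 ++ [y]) :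
      {z : A | ∀ t ∈ s', IncompRel (· ≤ ·) z t} =
        incompResidual {z : A | ∀ t ∈ s.1, IncompRel (· ≤ ·) z t} y := by
    ext z
    simp [hs', incompResidual, or_imp, forall_and]
  apply le_antisymm
  · rw [IsWellFounded.rank_eq, Ordinal.iSup_le_iff]
    rintro ⟨t, y, hy⟩
    rw [Order.succ_le_iff, ih t ⟨y, hy⟩, hres y t.1 hy]
    refine setWidth_incompResidual_lt fun x hx => ?_
    have := t.2.2
    rw [hy, List.pairwise_append] at this
    exact (this.2.2 x hx y (by simp)).symm
  · rw [setWidth_le_iff]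
    intro y hy
    let t : Inco A := ⟨s.1 ++ [y], by simp,
      List.pairwise_append.2 ⟨s.2.2, by simp, fun x hx z hz => by
        rw [List.mem_singleton.1 hz]; exact (hy x hx).symm⟩⟩
    rw [← hres y t.1 rfl, ← ih t ⟨y, rfl⟩]
    exact IsWellFounded.rank_lt_of_rel ⟨y, rfl⟩

theorem width_eq_setWidth_univ : width A = setWidth (Set.univ : Set A) := by
  apply le_antisymm
  · rw [width, Ordinal.iSup_le_iff]
    intro s
    rw [Order.add_one_le_iff, rank_child_eq_setWidth]
    obtain ⟨x, hx⟩ := List.exists_mem_of_ne_nil s.1 s.2.1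
    refine (setWidth_mono ?_).trans_lt (setWidth_incompResidual_lt (Set.mem_univ x))
    exact fun z hz => ⟨trivial, hz x hx⟩
  · rw [setWidth_le_iff]
    intro y _
    let s : Inco A := ⟨[y], by simp, by simp⟩
    have : incompResidual Set.univ y = {z : A | ∀ t ∈ s.1, IncompRel (· ≤ ·) z t} := by
      ext z
      simp [incompResidual, s]
    rw [this, ← rank_child_eq_setWidth]
    exact (Order.lt_add_one_iff.2 le_rfl).trans_le
      (Ordinal.le_iSup (fun s : Inco A => IsWellFounded.rank Inco.Child s + 1) s)

/-- The width of a set is at most the natural sum of the widths of the parts of a finite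
partition. -/
theorem setWidth_le_natSum {ι : Type*} (s : Finset ι) (c : A → ι) {S : Set A}
    (hc : ∀ x ∈ S, c x ∈ s) : setWidth S ≤ natSum s fun i => setWidth (S ∩ c ⁻¹' {i}) := by
  induction S using incompResidual_induction with | _ S ih
  rw [setWidth_le_iff]
  intro y hy
  refine (ih y hy fun x hx => hc x hx.1).trans_lt ?_
  -- The move `y` strictly lowers the width of its own part and raises none.
  refine natSum_lt_natSum (fun i _ => setWidth_mono ?_) (hc y hy)
    (setWidth_incompResidual_inter_lt hy _ rfl)
  exact Set.inter_subset_inter_left _ (incompResidual_subset S y)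

/-- If the elements of `U` can be played first so that what is left over has width at least `δ`,
then the width of `S` is at least `δ + setWidth U`. -/
theorem add_setWidth_le {S U : Set A} (hU : U ⊆ S) {δ : Ordinal.{u}}
    (h : ∀ F : Set A, F.Finite → F ⊆ U →
      δ ≤ setWidth {z ∈ S | ∀ t ∈ F, IncompRel (· ≤ ·) z t}) :
    δ + setWidth U ≤ setWidth S := by
  induction U using incompResidual_induction generalizing S with | _ U ih
  have h0 : δ ≤ setWidth S := by simpa using h ∅ Set.finite_empty (Set.empty_subset _)
  rcases eq_or_ne (setWidth U) 0 with hU0 | hU0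
  · rwa [hU0, add_zero]
  rw [Ordinal.add_le_iff hU0]
  intro d hd
  obtain ⟨y, hy, hdy⟩ := lt_setWidth_iff.1 hd
  refine (add_le_add_right hdy δ).trans_lt ?_
  refine (ih y hy (S := incompResidual S y) (fun x hx => ⟨hU hx.1, hx.2⟩)
    fun F hF hFU => ?_).trans_lt (setWidth_incompResidual_lt (hU hy))
  -- The move `y` joins the finite set already played, so the hypothesis passes to the residual of
  -- `S`.
  refine (h (insert y F) (hF.insert y) ?_).trans (setWidth_mono ?_)
  · exact Set.insert_subset hy fun x hx => (hFU hx).1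
  · exact fun z hz => ⟨⟨hz.1, hz.2 y (by simp)⟩, fun t ht => hz.2 t (by simp [ht])⟩

/-- A lower bound for the width: parts `C q`, indexed by a finite partial order, such that the
width of `C q` is at least `ω ^ γ q` even after removing the elements that are comparable to an
element of a given finite set contained in the `C r` with `¬ r ≤ q`. -/
theorem natSum_le_setWidth_univ {Q : Type*} [PartialOrder Q] (s : Finset Q) (C : Q → Set A)
    (γ : Q → Ordinal.{u}) (hγ : ∀ q ∈ s, ∀ r ∈ s, q ≤ r → γ r ≤ γ q)
    (h : ∀ q ∈ s, ∀ T : Set A, T.Finite → (∀ t ∈ T, ∃ r ∈ s, ¬ r ≤ q ∧ t ∈ C r) →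
      Ordinal.omega0 ^ γ q ≤ setWidth {z ∈ C q | ∀ t ∈ T, IncompRel (· ≤ ·) z t}) :
    natSum s (fun q => Ordinal.omega0 ^ γ q) ≤ setWidth (Set.univ : Set A) := by
  classical
  -- Generalised for induction: `s'` is the lower set of parts still to be played, and `T` consists
  -- of the moves made in the other parts.
  suffices H : ∀ s' ⊆ s, (∀ q ∈ s', ∀ r ∈ s, r ≤ q → r ∈ s') → ∀ T : Set A, T.Finite →
      (∀ t ∈ T, ∃ r ∈ s \ s', t ∈ C r) →
      natSum s' (fun q => Ordinal.omega0 ^ γ q) ≤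
        setWidth {z : A | ∀ t ∈ T, IncompRel (· ≤ ·) z t} by
    simpa using H s subset_rfl (fun q _ r hr _ => hr) ∅ Set.finite_empty (by simp)
  intro s'
  induction s' using Finset.strongInduction with | _ s' ih
  intro hs' hlow T hT hTC
  rcases s'.eq_empty_or_nonempty with rfl | hne
  · simp
  -- The part to play next has least exponent, so its power can be added last. Taking it maximal
  -- among those makes it maximal in `s'`, as `γ` is antitone, so `s'.erase q` is again a lower set.
  obtain ⟨q₀, hq₀, hmin⟩ := s'.exists_min_image γ hne
  obtain ⟨q, hq, hmax⟩ := (s'.filter (γ · = γ q₀)).exists_maximal ⟨q₀, by simp [hq₀]⟩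
  obtain ⟨hq, hqγ⟩ := Finset.mem_filter.1 hq
  have hqmax : ∀ r ∈ s', q ≤ r → r = q := fun r hr hqr =>
    (hmax (Finset.mem_filter.2 ⟨hr, ((hγ q (hs' hq) r (hs' hr) hqr).trans hqγ.le).antisymm
      (hmin r hr)⟩) hqr).antisymm hqr
  rw [natSum_omega0_opow_eq_add hq fun r hr => hqγ.trans_le (hmin r hr)]
  refine (add_le_add_right (h q (hs' hq) T hT fun t ht => ?_) _).trans
    (add_setWidth_le (fun z hz => hz.2) fun F hF hFU => ?_)
  · obtain ⟨r, hr, htr⟩ := hTC t ht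
    rw [Finset.mem_sdiff] at hr
    exact ⟨r, hr.1, fun hrq => hr.2 (hlow q hq r hr.1 hrq), htr⟩
  · refine (ih (s'.erase q) (Finset.erase_ssubset hq) ((Finset.erase_subset _ _).trans hs')
      (fun r hr p hp hpr => ?_) (T ∪ F) (hT.union hF) fun t ht => ?_).trans (setWidth_mono ?_)
    · rw [Finset.mem_erase] at hr ⊢
      refine ⟨?_, hlow r hr.2 p hp hpr⟩
      rintro rfl
      exact hr.1 (hqmax r hr.2 hpr)
    · rcases ht with ht | ht
      · obtain ⟨r, hr, htr⟩ := hTC t ht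
        rw [Finset.mem_sdiff] at hr
        exact ⟨r, by simp [hr], htr⟩
      · exact ⟨q, by simp [hs' hq], (hFU ht).1⟩
    · exact fun z hz => ⟨fun t ht => hz t (Or.inl ht), fun t ht => hz t (Or.inr ht)⟩

end SetWidth

/-! ### Decomposition of an ordinal into blocks of indecomposable order type -/

section Blocks

variable {K : Type u} [LinearOrder K]

/-- A subset of a linear order is shiftable if it embeds into each of its final segments. -/
def Shiftable (s : Set K) : Prop :=
  ∀ c ∈ s, ∃ f : K → K, StrictMonoOn f s ∧ Set.MapsTo f s s ∧ ∀ x ∈ s, c < f x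

theorem Shiftable.exists_forall_lt {s : Set K} (hs : Shiftable s) {T : Set K} (hT : T.Finite) :
    ∃ f : K → K, StrictMonoOn f s ∧ Set.MapsTo f s s ∧ ∀ t ∈ T, t ∈ s → ∀ x ∈ s, t < f x := by
  rcases (T ∩ s).eq_empty_or_nonempty with h | h
  · refine ⟨id, strictMonoOn_id, fun x hx => hx, fun t ht hts => ?_⟩
    exact absurd (show t ∈ T ∩ s from ⟨ht, hts⟩) (by simp [h])
  · obtain ⟨c, hc, hmax⟩ := Set.exists_max_image _ id (hT.inter_of_left s) h
    obtain ⟨f, hf, hfs, hcf⟩ := hs c hc.2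
    exact ⟨f, hf, hfs, fun t ht hts x hx => (hmax t ⟨ht, hts⟩).trans_lt (hcf x hx)⟩

/-- The fibres of `idx` decompose a linear order into `l` consecutive blocks, of nonincreasing
order types, the first of which is shiftable and each of which is shiftable or a singleton. -/
structure IsBlockDecomposition (idx : K → ℕ) (l : ℕ) : Prop where
  monotone : Monotone idx
  idx_lt : ∀ x, idx x < l
  nonempty : ∀ j < l, ∃ x, idx x = j
  embed : ∀ j k, j ≤ k → k < l →
    ∃ f : K → K, StrictMonoOn f (idx ⁻¹' {k}) ∧ Set.MapsTo f (idx ⁻¹' {k}) (idx ⁻¹' {j})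
  subsingleton_or_shiftable : ∀ j < l, (idx ⁻¹' {j}).Subsingleton ∨ Shiftable (idx ⁻¹' {j})
  shiftable_zero : Shiftable (idx ⁻¹' {0})
  pos : 0 < l

/-- Cantor normal form with repeated terms: `a` lists the exponents and `e` the partial sums. The
leading power is removed and the remainder treated recursively. -/
theorem exists_sum_omega0_opow (α : Ordinal.{u}) :
    ∃ (l : ℕ) (e a : ℕ → Ordinal.{u}), e 0 = 0 ∧ e l = α ∧ (∀ j < l, e (j + 1) = e j + ω ^ a j) ∧
      (∀ j k, j ≤ k → k < l → a k ≤ a j) ∧ (∀ j < l, a j ≤ Ordinal.log ω α) ∧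
      (α ≠ 0 → 0 < l ∧ a 0 = Ordinal.log ω α) := by
  induction α using WellFoundedLT.induction with | _ α ih
  rcases eq_or_ne α 0 with rfl | hα
  · exact ⟨0, fun _ => 0, fun _ => 0, by simp⟩
  have hlt := (Ordinal.isLeast_sub_lt_omega0_opow_log hα).1
  have hle := Ordinal.opow_log_le_self ω hα
  obtain ⟨l, e, a, he0, hel, hes, ha, hlog, -⟩ := ih _ hlt
  have hlog' : ∀ j < l, a j ≤ Ordinal.log ω α := fun j hj =>
    (hlog j hj).trans (Ordinal.log_mono_right ω (le_of_lt hlt))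
  refine ⟨l + 1, fun j => Nat.casesOn j 0 fun j => ω ^ Ordinal.log ω α + e j,
    fun j => Nat.casesOn j (Ordinal.log ω α) a, rfl, ?_, ?_, ?_, ?_, ?_⟩
  · simp only [hel]
    exact Ordinal.add_sub_cancel_of_le hle
  · rintro (_ | j) hj
    · simp [he0]
    · simp only [hes j (by omega), add_assoc]
  · rintro (_ | j) (_ | k) hjk hk
    · exact le_rfl
    · exact hlog' k (by omega)
    · omega
    · exact ha j k (by omega) (by omega)
  · rintro (_ | j) hj
    · exact le_rfl
    · exact hlog' j (by omega)
  · exact fun _ => ⟨by omega, rfl⟩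

/-- The ordinal position of an element of `α.ToType`. -/
noncomputable def position {α : Ordinal.{u}} (x : α.ToType) : Ordinal.{u} :=
  (Ordinal.ToType.toOrd x : Ordinal.{u})

theorem position_lt {α : Ordinal.{u}} (x : α.ToType) : position x < α :=
  (Ordinal.ToType.toOrd x).2

theorem position_lt_position {α : Ordinal.{u}} {x y : α.ToType} :
    position x < position y ↔ x < y :=
  (Ordinal.ToType.mk (o := α)).symm.lt_iff_lt

theorem exists_position_eq {α o : Ordinal.{u}} (h : o < α) : ∃ x : α.ToType, position x = o :=
  ⟨Ordinal.ToType.mk ⟨o, h⟩, by simp [position]⟩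

theorem exists_map_position {α : Ordinal.{u}} {s : Set α.ToType} (F : Ordinal.{u} → Ordinal.{u})
    (hF : ∀ x ∈ s, F (position x) < α) :
    ∃ f : α.ToType → α.ToType, ∀ x ∈ s, position (f x) = F (position x) := by
  classical
  have (x : α.ToType) : ∃ y : α.ToType, x ∈ s → position y = F (position x) := by
    by_cases hx : x ∈ s
    · exact (exists_position_eq (hF x hx)).imp fun y hy _ => hy
    · exact ⟨x, fun h => absurd h hx⟩
  choose f hf using this
  exact ⟨f, hf⟩

theorem exists_isBlockDecomposition {α : Ordinal.{u}} (hα : ω ≤ α) :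
    ∃ (idx : α.ToType → ℕ) (l : ℕ), IsBlockDecomposition idx l := by
  classical
  obtain ⟨l, e, a, he0, hel, hes, ha, -, hl⟩ := exists_sum_omega0_opow α
  have hα0 : α ≠ 0 := (Ordinal.omega0_pos.trans_le hα).ne'
  obtain ⟨hl, ha0⟩ := hl hα0
  -- Here infiniteness of `α` enters: the first block is not a singleton.
  have ha0 : a 0 ≠ 0 := by
    rw [ha0]
    exact (Ordinal.log_pos Ordinal.one_lt_omega0 hα0 hα).ne'
  have hmono : ∀ j k, j ≤ k → k ≤ l → e j ≤ e k := by
    intro j k hjk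
    induction k, hjk using Nat.le_induction with
    | base => exact fun _ => le_rfl
    | succ k hjk ih =>
      intro hk
      rw [hes k (by omega)]
      exact (ih (by omega)).trans le_self_add
  let idx : α.ToType → ℕ := fun x => Nat.findGreatest (fun j => e j ≤ position x) l
  have hidx_le (x : α.ToType) : e (idx x) ≤ position x :=
    Nat.findGreatest_spec (P := fun j => e j ≤ position x) (zero_le) (by simp [he0])
  have hidx_lt (x : α.ToType) : idx x < l := by
    refine (Nat.findGreatest_le l).lt_of_ne fun h => ?_
    have := hidx_le x
    rw [show idx x = l from h, hel] at this
    exact (position_lt x).not_ge this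
  have hlt_idx (x : α.ToType) : position x < e (idx x + 1) := by
    by_contra! h
    have := Nat.le_findGreatest (P := fun j => e j ≤ position x) (hidx_lt x) h
    exact (Nat.lt_succ_self _).not_ge this
  have hidx_eq (x : α.ToType) (j : ℕ) (hj : j < l) :
      idx x = j ↔ ∃ z < ω ^ a j, position x = e j + z := by
    constructor
    · rintro rfl
      refine ⟨position x - e (idx x), ?_, (Ordinal.add_sub_cancel_of_le (hidx_le x)).symm⟩
      rw [Ordinal.sub_lt_of_le (hidx_le x), ← hes _ hj]
      exact hlt_idx x
    · rintro ⟨z, hz, hx⟩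
      apply le_antisymm
      · by_contra! h
        have := (hmono _ _ h (hidx_lt x).le).trans (hidx_le x)
        rw [Nat.succ_eq_add_one, hes j hj, hx, add_le_add_iff_left] at this
        exact this.not_gt hz
      · exact Nat.le_findGreatest hj.le (hx ▸ le_self_add)
  have hlt_α (j : ℕ) (hj : j < l) (z : Ordinal.{u}) (hz : z < ω ^ a j) : e j + z < α := by
    calc e j + z < e j + ω ^ a j := by simpa using hz
      _ = e (j + 1) := (hes j hj).symm
      _ ≤ e l := hmono _ _ hj le_rfl
      _ = α := hel
  have hshift (j : ℕ) (hj : j < l) (h0 : a j ≠ 0) : Shiftable (idx ⁻¹' {j}) := by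
    intro c hc
    obtain ⟨d, hd, hc⟩ := (hidx_eq c j hj).1 hc
    have hprin := Ordinal.isPrincipal_add_omega0_opow (a j)
    have hlt (z : Ordinal.{u}) (hz : z < ω ^ a j) : d + 1 + z < ω ^ a j :=
      hprin (hprin hd (Ordinal.one_lt_opow.2 ⟨Ordinal.one_lt_omega0, h0⟩)) hz
    -- Adding `d + 1` on the left of the offset moves the block past `c`; it stays in the block
    -- since `ω ^ a j` is additively indecomposable.
    obtain ⟨f, hf⟩ := exists_map_position (s := idx ⁻¹' {j})
      (fun y => e j + (d + 1 + (y - e j))) (fun x hx => by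
        obtain ⟨z, hz, hx⟩ := (hidx_eq x j hj).1 hx
        simpa [hx] using hlt_α j hj _ (hlt z hz))
    refine ⟨f, fun x hx y hy hxy => ?_, fun x hx => ?_, fun x hx => ?_⟩
    · rw [← position_lt_position] at hxy ⊢
      rw [hf x hx, hf y hy]
      obtain ⟨z, hz, hx⟩ := (hidx_eq x j hj).1 hx
      obtain ⟨w, hw, hy⟩ := (hidx_eq y j hj).1 hy
      simpa [hx, hy] using hxy
    · have := hf x hx
      obtain ⟨z, hz, hx⟩ := (hidx_eq x j hj).1 hx
      exact (hidx_eq _ j hj).2 ⟨_, hlt z hz, by simpa [hx] using this⟩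
    · rw [← position_lt_position, hf x hx, hc, add_lt_add_iff_left]
      exact (Order.lt_add_one_iff.2 le_rfl).trans_le le_self_add
  refine ⟨idx, l, ?_, hidx_lt, ?_, ?_, ?_, hshift 0 hl ha0, hl⟩
  · intro x y hxy
    refine Nat.findGreatest_mono (fun j hj => hj.trans ?_) le_rfl
    rw [← not_lt, position_lt_position]
    exact hxy.not_gt
  · intro j hj
    have h0 : (0 : Ordinal.{u}) < ω ^ a j := Ordinal.opow_pos _ Ordinal.omega0_pos
    obtain ⟨x, hx⟩ := exists_position_eq (hlt_α j hj 0 h0)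
    exact ⟨x, (hidx_eq x j hj).2 ⟨0, h0, hx⟩⟩
  · intro j k hjk hk
    have hj : j < l := hjk.trans_lt hk
    have hpow : ω ^ a k ≤ ω ^ a j := Ordinal.opow_le_opow_right Ordinal.omega0_pos (ha j k hjk hk)
    obtain ⟨f, hf⟩ := exists_map_position (s := idx ⁻¹' {k})
      (fun y => e j + (y - e k)) (fun x hx => by
        obtain ⟨z, hz, hx⟩ := (hidx_eq x k hk).1 hx
        simpa [hx] using hlt_α j hj _ (hz.trans_le hpow))
    refine ⟨f, fun x hx y hy hxy => ?_, fun x hx => ?_⟩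
    · rw [← position_lt_position] at hxy ⊢
      rw [hf x hx, hf y hy]
      obtain ⟨z, hz, hx⟩ := (hidx_eq x k hk).1 hx
      obtain ⟨w, hw, hy⟩ := (hidx_eq y k hk).1 hy
      simpa [hx, hy] using hxy
    · have := hf x hx
      obtain ⟨z, hz, hx⟩ := (hidx_eq x k hk).1 hx
      exact (hidx_eq _ j hj).2 ⟨z, hz.trans_le hpow, by simpa [hx] using this⟩
  · intro j hj
    by_cases h0 : a j = 0
    · refine Or.inl fun x hx y hy => ?_
      obtain ⟨z, hz, hx⟩ := (hidx_eq x j hj).1 hx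
      obtain ⟨w, hw, hy⟩ := (hidx_eq y j hj).1 hy
      simp only [h0, Ordinal.opow_zero, Order.lt_one_iff] at hz hw
      refine le_antisymm ?_ ?_ <;> rw [← not_lt, ← position_lt_position] <;> simp [hx, hy, hz, hw]
    · exact Or.inr (hshift j hj h0)

end Blocks

/-! ### Boxes in products of well-orders -/

section Box

variable {ι : Type*} {K : ι → Type u}

theorem update_mem_box [DecidableEq ι] {s : ∀ i, Set (K i)} {x : ∀ i, K i}
    (hx : x ∈ Set.univ.pi s) {i : ι} {a : K i} (ha : a ∈ s i) :
    Function.update x i a ∈ Set.univ.pi s := by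
  intro j _
  rcases eq_or_ne j i with rfl | hj
  · simpa using ha
  · simpa [hj] using hx j trivial

variable [∀ i, LinearOrder (K i)]

theorem incompRel_map_of_strictMonoOn {s : ∀ i, Set (K i)} {φ : ∀ i, K i → K i}
    (hφ : ∀ i, StrictMonoOn (φ i) (s i)) {x y : ∀ i, K i} (hx : x ∈ Set.univ.pi s)
    (hy : y ∈ Set.univ.pi s) (h : IncompRel (· ≤ ·) x y) :
    IncompRel (· ≤ ·) (fun i => φ i (x i)) (fun i => φ i (y i)) :=
  ⟨fun hle => h.1 fun i => ((hφ i).le_iff_le (hx i trivial) (hy i trivial)).1 (hle i),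
    fun hle => h.2 fun i => ((hφ i).le_iff_le (hy i trivial) (hx i trivial)).1 (hle i)⟩

end Box

/-! ### Widths of boxes with indecomposable sides -/

section BoxWidth

variable {ι : Type} [Fintype ι] {K : ι → Type u} [∀ i, LinearOrder (K i)]
  [∀ i, WellFoundedLT (K i)]

theorem setWidth_le_of_strictMonoOn {s : ∀ i, Set (K i)} {φ : ∀ i, K i → K i}
    (hφ : ∀ i, StrictMonoOn (φ i) (s i)) {S T : Set (∀ i, K i)} (hS : S ⊆ Set.univ.pi s)
    (hST : ∀ x ∈ S, (fun i => φ i (x i)) ∈ T) : setWidth S ≤ setWidth T :=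
  setWidth_le_of_map _ hST fun _ hx _ hy h => incompRel_map_of_strictMonoOn hφ (hS hx) (hS hy) h

theorem setWidth_le_of_strictMonoOn_update [DecidableEq ι] {s : ∀ i, Set (K i)} {i : ι}
    {f : K i → K i} (hf : StrictMonoOn f (s i)) {S T : Set (∀ i, K i)}
    (hS : S ⊆ Set.univ.pi s) (hST : ∀ x ∈ S, Function.update x i (f (x i)) ∈ T) :
    setWidth S ≤ setWidth T := by
  refine setWidth_le_of_strictMonoOn
    (φ := Function.update (β := fun i => K i → K i) (fun _ => id) i f) (fun j => ?_) hS
    fun x hx => ?_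
  · rcases eq_or_ne j i with rfl | hj
    · simpa using hf
    · simpa [hj] using strictMonoOn_id
  · convert hST x hx using 1
    ext j
    rcases eq_or_ne j i with rfl | hj
    · simp
    · simp [hj]

/-- The part of a box cut off by `c` in direction `i`. -/
def slab (s : ∀ i, Set (K i)) (i : ι) (c : K i) : Set (∀ i, K i) :=
  {y ∈ Set.univ.pi s | y i < c}

/-- A copy of the slab at `c`, moved beyond `d` in direction `i`, is played first; a full copy of
the slab at `d` survives any finite part of that play. -/
theorem exists_slab_add_slab_le {s : ∀ i, Set (K i)} {i i' : ι} (hii' : i' ≠ i)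
    (hi : Shiftable (s i)) (hi' : Shiftable (s i')) {c d : K i} (hc : c ∈ s i) (hd : d ∈ s i) :
    ∃ c' ∈ s i, setWidth (slab s i d) + setWidth (slab s i c) ≤ setWidth (slab s i c') := by
  classical
  obtain ⟨f, hf, hfs, hdf⟩ := hi d hd
  refine ⟨f c, hfs hc, ?_⟩
  have hle : setWidth (slab s i c) ≤ setWidth {y ∈ slab s i (f c) | d < y i} :=
    setWidth_le_of_strictMonoOn_update hf (fun y hy => hy.1) fun y hy =>
      ⟨⟨update_mem_box hy.1 (hfs (hy.1 i trivial)), by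
        simpa using hf (hy.1 i trivial) hc hy.2⟩, by simpa using hdf _ (hy.1 i trivial)⟩
  refine (add_le_add_right hle _).trans (add_setWidth_le (fun y hy => hy.1) fun F hF hFU => ?_)
  -- Points of the slab at `d` lie below `F` in direction `i`; shifting them above `F` in direction
  -- `i'` makes them incomparable to `F`.
  obtain ⟨g, hg, hgs, hFg⟩ := hi'.exists_forall_lt (hF.image fun t => t i')
  refine setWidth_le_of_strictMonoOn_update hg (fun y hy => hy.1) fun y hy => ⟨⟨?_, ?_⟩, ?_⟩
  · exact update_mem_box hy.1 (hgs (hy.1 i' trivial))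
  · simpa [hii'.symm] using hy.2.trans (hdf c hc)
  · intro t ht
    have htU := hFU ht
    constructor
    · intro hle
      have := hle i'
      rw [Function.update_self] at this
      exact this.not_gt (hFg _ ⟨t, ht, rfl⟩ (htU.1.1 i' trivial) _ (hy.1 i' trivial))
    · intro hle
      have := hle i
      rw [Function.update_of_ne hii'.symm] at this
      exact this.not_gt (hy.2.trans htU.2)

theorem slab_mul_natCast_le {s : ∀ i, Set (K i)} {i i' : ι} (hii' : i' ≠ i)
    (hi : Shiftable (s i)) (hi' : Shiftable (s i')) {c : K i} (hc : c ∈ s i) (n : ℕ) :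
    setWidth (slab s i c) * n ≤ setWidth (Set.univ.pi s) := by
  suffices ∃ d ∈ s i, setWidth (slab s i c) * n ≤ setWidth (slab s i d) by
    obtain ⟨d, -, h⟩ := this
    exact h.trans (setWidth_mono fun y hy => hy.1)
  induction n with
  | zero => exact ⟨c, hc, by simp⟩
  | succ n ih =>
    obtain ⟨d, hd, h⟩ := ih
    obtain ⟨c', hc', h'⟩ := exists_slab_add_slab_le hii' hi hi' hc hd
    refine ⟨c', hc', le_trans ?_ h'⟩
    rw [Nat.cast_succ, mul_add_one]
    exact add_le_add_left h _

/-- A point not above `x` is below `x` in some coordinate, so the slabs cover the residual. -/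
theorem setWidth_incompResidual_box_le [Nonempty ι] (s : ∀ i, Set (K i)) (x : ∀ i, K i) :
    setWidth (incompResidual (Set.univ.pi s) x) ≤
      natSum Finset.univ fun i => setWidth (slab s i (x i)) := by
  classical
  have (y : ∀ i, K i) : ∃ i, y ∈ incompResidual (Set.univ.pi s) x → y i < x i := by
    by_cases hy : y ∈ incompResidual (Set.univ.pi s) x
    · by_contra! h
      exact hy.2.2 fun i => (h i).2
    · exact ⟨Classical.arbitrary ι, fun h => absurd h hy⟩
  choose c hc using this
  refine (setWidth_le_natSum Finset.univ c fun _ _ => Finset.mem_univ _).trans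
    (natSum_le_natSum fun i _ => setWidth_mono ?_)
  rintro y ⟨hy, rfl⟩
  exact ⟨hy.1, hc y hy⟩

/-- The width of a nonempty box with shiftable or trivial sides is a power of `ω`. -/
theorem exists_setWidth_box_eq [Nonempty ι] {s : ∀ i, Set (K i)}
    (hs : ∀ i, (s i).Subsingleton ∨ Shiftable (s i)) (hne : (Set.univ.pi s).Nonempty) :
    ∃ γ : Ordinal.{u}, setWidth (Set.univ.pi s) = ω ^ γ := by
  have hpos := setWidth_pos hne
  -- With at most one nontrivial side the box is a chain, of width `1 = ω ^ 0`.
  by_cases h : ∃ i₀, ∀ i ≠ i₀, (s i).Subsingleton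
  · obtain ⟨i₀, hi₀⟩ := h
    refine ⟨0, le_antisymm ?_ (by simpa using Order.one_le_iff_pos.2 hpos)⟩
    rw [setWidth_le_iff]
    intro x hx
    have hle {y z : ∀ i, K i} (hy : y ∈ Set.univ.pi s) (hz : z ∈ Set.univ.pi s)
        (hyz : y i₀ ≤ z i₀) : y ≤ z := fun i => by
      rcases eq_or_ne i i₀ with rfl | hi
      · exact hyz
      · exact (hi₀ i hi (hy i trivial) (hz i trivial)).le
    have : incompResidual (Set.univ.pi s) x = ∅ := by
      refine Set.eq_empty_iff_forall_notMem.2 fun y hy => ?_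
      rcases le_total (y i₀) (x i₀) with h | h
      · exact hy.2.1 (hle hy.1 hx h)
      · exact hy.2.2 (hle hx hy.1 h)
    rw [this, Ordinal.opow_zero]
    refine lt_of_le_of_lt (setWidth_le_iff.2 ?_) zero_lt_one
    simp
  · push Not at h
    -- Every smaller ordinal lies below a power of `ω` that does not exceed the width; hence the
    -- width is additively indecomposable.
    have key : ∀ a < setWidth (Set.univ.pi s),
        ∃ e : Ordinal.{u}, a < ω ^ e ∧ ω ^ e ≤ setWidth (Set.univ.pi s) := by
      intro a ha
      obtain ⟨x, hx, hax⟩ := lt_setWidth_iff.1 ha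
      obtain ⟨e, he, he'⟩ := exists_natSum_lt_omega0_opow (s := Finset.univ)
        (a := fun i => setWidth (slab s i (x i))) hpos.ne' fun i _ n => by
          rcases hs i with hi | hi
          · have : slab s i (x i) = ∅ := Set.eq_empty_iff_forall_notMem.2 fun y hy =>
              hy.2.ne (hi (hy.1 i trivial) (hx i trivial))
            have : setWidth (slab s i (x i)) ≤ 0 := setWidth_le_iff.2 (by simp [this])
            rw [nonpos_iff_eq_zero.1 this, zero_mul]
            exact hpos.le
          · obtain ⟨i', hii', hi'⟩ := h i
            exact slab_mul_natCast_le hii' hi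
              ((hs i').resolve_left (Set.not_subsingleton_iff.2 hi')) (hx i trivial) n
      exact ⟨e, (hax.trans (setWidth_incompResidual_box_le s x)).trans_lt he, he'⟩
    have hprin : Ordinal.IsPrincipal (· + ·) (setWidth (Set.univ.pi s)) := by
      intro a b ha hb
      obtain ⟨e, he, he'⟩ := key _ (max_lt ha hb)
      exact (Ordinal.isPrincipal_add_omega0_opow e ((le_max_left _ _).trans_lt he)
        ((le_max_right _ _).trans_lt he)).trans_le he'
    rcases Ordinal.isPrincipal_add_iff_zero_or_omega0_opow.1 hprin with h0 | ⟨γ, hγ⟩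
    · exact absurd h0 hpos.ne'
    · exact ⟨γ, hγ.symm⟩

end BoxWidth

/-! ### Products of ordinals -/

section Product

variable {ι : Type} {K : ι → Type u}

/-- The block with index `j` of a product of linear orders that are divided into blocks. -/
def block (idx : ∀ i, K i → ℕ) (j : ι → ℕ) : Set (∀ i, K i) :=
  Set.univ.pi fun i => idx i ⁻¹' {j i}

theorem mem_block {idx : ∀ i, K i → ℕ} {j : ι → ℕ} {x : ∀ i, K i} :
    x ∈ block idx j ↔ ∀ i, idx i (x i) = j i := by
  simp [block]

variable [Fintype ι]

/-- The indices of the blocks that are not above any other block in all coordinates. -/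
def minimalIndices [DecidableEq ι] (l : ι → ℕ) : Finset (ι → ℕ) :=
  (Fintype.piFinset fun i => Finset.range (l i)).filter fun j => ∃ i, j i = 0

theorem mem_minimalIndices [DecidableEq ι] {l j : ι → ℕ} :
    j ∈ minimalIndices l ↔ (∀ i, j i < l i) ∧ ∃ i, j i = 0 := by
  simp [minimalIndices]

variable [∀ i, LinearOrder (K i)] [∀ i, WellFoundedLT (K i)] {idx : ∀ i, K i → ℕ} {l : ι → ℕ}

theorem setWidth_block_anti (h : ∀ i, IsBlockDecomposition (idx i) (l i)) {j k : ι → ℕ}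
    (hjk : j ≤ k) (hk : ∀ i, k i < l i) :
    setWidth (block idx k) ≤ setWidth (block idx j) := by
  choose f hf hfj using fun i => (h i).embed (j i) (k i) (hjk i) (hk i)
  exact setWidth_le_of_strictMonoOn hf subset_rfl fun x hx i _ => hfj i (hx i trivial)

theorem exists_setWidth_block_eq [Nonempty ι] (h : ∀ i, IsBlockDecomposition (idx i) (l i))
    {j : ι → ℕ} (hj : ∀ i, j i < l i) : ∃ γ : Ordinal.{u}, setWidth (block idx j) = ω ^ γ := by
  refine exists_setWidth_box_eq (fun i => (h i).subsingleton_or_shiftable _ (hj i)) ?_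
  choose x hx using fun i => (h i).nonempty (j i) (hj i)
  exact ⟨x, mem_block.2 hx⟩

/-- Group the blocks along diagonals by subtracting the least index from all indices. Distinct
blocks on a diagonal are entirely comparable, so one move confines the rest of the play on that
diagonal to a single block, no wider than the minimal one. -/
theorem setWidth_univ_le_natSum_block [DecidableEq ι] [Nonempty ι]
    (h : ∀ i, IsBlockDecomposition (idx i) (l i)) :
    setWidth (Set.univ : Set (∀ i, K i)) ≤
      natSum (minimalIndices l) fun j => setWidth (block idx j) := by
  have (x : ∀ i, K i) : ∃ i₀, ∀ i, idx i₀ (x i₀) ≤ idx i (x i) := by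
    obtain ⟨i₀, -, hi₀⟩ := Finset.exists_min_image Finset.univ (fun i => idx i (x i))
      Finset.univ_nonempty
    exact ⟨i₀, fun i => hi₀ i (Finset.mem_univ i)⟩
  choose i₀ hi₀ using this
  let c : (∀ i, K i) → ι → ℕ := fun x i => idx i (x i) - idx (i₀ x) (x (i₀ x))
  have hc (x : ∀ i, K i) : c x ∈ minimalIndices l := by
    refine mem_minimalIndices.2 ⟨fun i => ?_, i₀ x, by simp [c]⟩
    exact (Nat.sub_le _ _).trans_lt ((h i).idx_lt _)
  have hlt {x y : ∀ i, K i} (hxy : c x = c y)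
      (hlt : idx (i₀ x) (x (i₀ x)) < idx (i₀ y) (y (i₀ y))) : x ≤ y := fun i => by
    by_contra! hyx
    have h₁ := (h i).monotone hyx.le
    have h₂ := congrFun hxy i
    have h₃ := hi₀ x i
    have h₄ := hi₀ y i
    simp only [c] at h₂
    omega
  refine (setWidth_le_natSum _ c fun x _ => hc x).trans (natSum_le_natSum fun j hj => ?_)
  rw [setWidth_le_iff]
  rintro y ⟨-, rfl⟩
  have hy : y ∈ block idx fun i => idx i (y i) := mem_block.2 fun i => rfl
  refine lt_of_le_of_lt (setWidth_mono ?_) ((setWidth_incompResidual_lt hy).trans_le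
    (setWidth_block_anti h (fun i => Nat.sub_le _ _) fun i => (h i).idx_lt _))
  rintro x ⟨⟨-, hxy⟩, hinc⟩
  refine ⟨mem_block.2 fun i => ?_, hinc⟩
  rcases lt_trichotomy (idx (i₀ x) (x (i₀ x))) (idx (i₀ y) (y (i₀ y))) with hm | hm | hm
  · exact absurd (hlt hxy hm) hinc.1
  · have h₂ := congrFun hxy i
    have h₃ := hi₀ x i
    have h₄ := hi₀ y i
    simp only [c] at h₂
    omega
  · exact absurd (hlt (Eq.symm hxy) hm) hinc.2

/-! ### Products with a finite partial order -/

variable {P : Type} [PartialOrder P] [WellQuasiOrderedLE P]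

/-- Shift the block past `T` in each coordinate where its index is `0`. A shifted point below `t`
would have index `0` wherever `t` does, against the shift; one above `t` would force `(k, q) ≤ (j,
p)`. -/
theorem setWidth_block_le_of_finite (h : ∀ i, IsBlockDecomposition (idx i) (l i)) {j : ι → ℕ}
    (p : P) {T : Set ((∀ i, K i) × P)} (hT : T.Finite)
    (hTj : ∀ t ∈ T, ∃ k : ι → ℕ, ∃ q : P, (∃ i, k i = 0) ∧ ¬ (k, q) ≤ (j, p) ∧
      t.1 ∈ block idx k ∧ t.2 = q) :
    setWidth (block idx j) ≤ setWidth {z : (∀ i, K i) × P |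
      (z.1 ∈ block idx j ∧ z.2 = p) ∧ ∀ t ∈ T, IncompRel (· ≤ ·) z t} := by
  have (i : ι) : ∃ f : K i → K i, StrictMonoOn f (idx i ⁻¹' {j i}) ∧
      Set.MapsTo f (idx i ⁻¹' {j i}) (idx i ⁻¹' {j i}) ∧ (j i = 0 → ∀ t ∈ T, idx i (t.1 i) = 0 →
        ∀ x, idx i x = 0 → t.1 i < f x) := by
    by_cases hj : j i = 0
    · obtain ⟨f, hf, hfs, hTf⟩ :=
        (h i).shiftable_zero.exists_forall_lt (hT.image fun t => t.1 i)
      rw [hj]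
      exact ⟨f, hf, hfs, fun _ t ht ht0 => hTf _ ⟨t, ht, rfl⟩ ht0⟩
    · exact ⟨id, strictMonoOn_id, fun x hx => hx, fun h => absurd h hj⟩
  choose f hf hfj hTf using this
  refine setWidth_le_of_map (fun x => (fun i => f i (x i), p)) (fun x hx => ?_)
    fun x hx y hy hxy => ?_
  · have hfx : (fun i => f i (x i)) ∈ block idx j := fun i _ => hfj i (hx i trivial)
    refine ⟨⟨hfx, rfl⟩, fun t ht => ?_⟩
    obtain ⟨k, q, ⟨i, hi⟩, hkj, htk, rfl⟩ := hTj t ht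
    rw [mem_block] at hfx htk hx
    constructor
    · intro hle
      have hji : j i = 0 := by
        have := (h i).monotone (hle.1 i)
        rw [htk i, hi] at this
        exact Nat.le_zero.1 ((hfx i).symm.trans_le this)
      exact (hle.1 i).not_gt (hTf i hji t ht ((htk i).trans hi) _ ((hx i).trans hji))
    · intro hle
      refine hkj ⟨fun i => ?_, hle.2⟩
      change k i ≤ j i
      rw [← htk i, ← hfx i]
      exact (h i).monotone (hle.1 i)
  · have := incompRel_map_of_strictMonoOn hf hx hy hxy
    exact ⟨fun hle => this.1 hle.1, fun hle => this.2 hle.1⟩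

theorem width_prod_eq [Nonempty ι] [Fintype P] (h : ∀ i, IsBlockDecomposition (idx i) (l i)) :
    width ((∀ i, K i) × P) =
      ofCoeffs (Fintype.card P • toCoeffs (width (∀ i, K i))) := by
  classical
  rw [width_eq_setWidth_univ, width_eq_setWidth_univ]
  apply le_antisymm
  · refine (setWidth_le_natSum Finset.univ Prod.snd fun _ _ => Finset.mem_univ _).trans ?_
    rw [← Finset.card_univ, ← natSum_const]
    refine natSum_le_natSum fun p _ => setWidth_le_of_map Prod.fst (fun _ _ => trivial) ?_
    rintro x ⟨-, rfl⟩ y ⟨-, hy⟩ hxy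
    exact ⟨fun hle => hxy.1 ⟨hle, hy.ge⟩, fun hle => hxy.2 ⟨hle, hy.le⟩⟩
  · have (j : ι → ℕ) : ∃ γ : Ordinal.{u}, j ∈ minimalIndices l →
        setWidth (block idx j) = ω ^ γ := by
      by_cases hj : j ∈ minimalIndices l
      · exact (exists_setWidth_block_eq h (mem_minimalIndices.1 hj).1).imp fun _ h _ => h
      · exact ⟨0, fun h => absurd h hj⟩
    choose γ hγ using this
    -- Only this upper bound for w(X) is needed: the lower bound in X × P is proved directly for the
    -- blocks.
    have hX := (setWidth_univ_le_natSum_block h).trans (natSum_le_natSum fun j hj => (hγ j hj).le)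
    calc ofCoeffs (Fintype.card P • toCoeffs (setWidth (Set.univ : Set (∀ i, K i))))
        ≤ natSum (Finset.univ : Finset P)
            (fun _ => natSum (minimalIndices l) fun j => ω ^ γ j) := by
          rw [← Finset.card_univ, ← natSum_const]
          exact natSum_le_natSum fun _ _ => hX
      _ = natSum (minimalIndices l ×ˢ (Finset.univ : Finset P)) fun q => ω ^ γ q.1 := by
          simp only [natSum, toCoeffs_ofCoeffs, Finset.sum_product_right]
      _ ≤ setWidth (Set.univ : Set ((∀ i, K i) × P)) := by
          refine natSum_le_setWidth_univ (A := (∀ i, K i) × P) (Q := (ι → ℕ) × P)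
            _ (fun q => {z | z.1 ∈ block idx q.1 ∧ z.2 = q.2}) (fun q => γ q.1)
            (fun q hq r hr hqr => ?_) fun q hq T hT hTC => ?_
          · have hq := (Finset.mem_product.1 hq).1
            have hr := (Finset.mem_product.1 hr).1
            have := setWidth_block_anti h hqr.1 (mem_minimalIndices.1 hr).1
            rwa [hγ _ hq, hγ _ hr,
              Ordinal.opow_le_opow_iff_right Ordinal.one_lt_omega0] at this
          · rw [← hγ _ (Finset.mem_product.1 hq).1]
            refine setWidth_block_le_of_finite h q.2 hT fun t ht => ?_
            obtain ⟨r, hr, hrq, htr⟩ := hTC t ht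
            exact ⟨r.1, r.2, (mem_minimalIndices.1 (Finset.mem_product.1 hr).1).2, hrq, htr⟩

end Product

theorem mainTheorem3 (n m : ℕ) (hn : 0 < n) (α : Fin n → Ordinal.{u})
    (hα : ∀ i, ω ≤ α i) (k : Fin m → ℕ) :
    width ((∀ i, (α i).ToType) × (∀ j, Fin (k j))) =
      (List.ofFn fun j => (k j : Ordinal.{u})).foldl natMul (width (∀ i, (α i).ToType)) := by
  have : Nonempty (Fin n) := ⟨⟨0, hn⟩⟩
  choose idx l h using fun i => exists_isBlockDecomposition (hα i)
  rw [width_prod_eq h, show (List.ofFn fun j => (k j : Ordinal.{u})) =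
    (List.ofFn k).map Nat.cast by rw [List.map_ofFn]; rfl, foldl_natMul_natCast, List.prod_ofFn]
  simp
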